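/- All graphs are finite and simple. For a graph $G$, let $N_r(G)$ be the number of cliques of size $r$ in $G$. A $k$-factor of $G$ is a $k$-regular spanning subgraph of $G$. The $l$-closure $C_l(G)$ is the graph obtained from $G$ by successively joining pairs of nonadjacent vertices whose degree sum is at least $l$, until no such pair exists. $K_m$ is the complete graph on $m$ vertices, $I_m$ the graph with $m$ vertices and no edges, $G_1+G_2$ the disjoint union of $G_1$ and $G_2$, and $G_1\vee G_2$ their join. Put $$\varphi(n,r,q)=\binom{n-q-1}{r}+(q+1)\binom{q}{r-1},\qquad \phi(n,r,k,q)=\binom{n-q+2k-4}{r}+(q-2k+4)\binom{q}{r-1}.$$ **Theorem.** Let $r\ge 2$, $k\ge 1$ and $\delta\ge 0$ be integers, and let $G$ be a graph of order $n\ge 2\delta+k+1$ with $nk$ even and minimum degree at least $\delta$. (i) Suppose that $n$ is even (which is automatic for $k=1$), that $1\le\delta\le\frac n2-1$, and that $N_r(G)>\max\{\varphi(n,r,\delta+1),\ \varphi(n,r,\frac n2-1)\}$. Then $G$ has a $1$-factor unless either $\delta$ is even and $C_{n-1}(G)\cong K_{n-\delta-1}+K_{\delta+1}$, or $C_{n-1}(G)\cong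 K_\delta\vee(K_{n-2\delta-1}+I_{\delta+1})$; in these exceptional cases $G$ has no $1$-factor. (ii) Suppose that $k\ge 2$, that $2k-2\le\delta\le\lfloor\frac{n+2k-5}{2}\rfloor$, and that $N_r(G)>\max\{\phi(n,r,k,\delta+1),\ \phi(n,r,k,\lfloor\frac{n+2k-5}{2}\rfloor)\}$. Then $G$ has a $k$-factor. -/

import Mathlib

namespace KFactor

/-- `G` has a `k`-factor: a `k`-regular spanning subgraph. -/
def HasFactor {V : Type*} (G : SimpleGraph V) (k : ℕ) : Prop :=
  ∃ F : SimpleGraph V, F ≤ G ∧ ∃ _ : F.LocallyFinite, F.IsRegularOfDegree k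

/-- The join of two vertex-disjoint graphs. -/
def graphJoin {V W : Type*} (G : SimpleGraph V) (H : SimpleGraph W) : SimpleGraph (V ⊕ W) :=
  (G ⊕g H) ⊔ completeBipartiteGraph V W

open Classical in
/-- `H` arises from `G` by joining one pair of distinct nonadjacent vertices whose degree sum in
`G` is at least `l`. -/
def ClosureStep {V : Type*} [Fintype V] (l : ℕ) (G H : SimpleGraph V) : Prop :=
  ∃ u v : V, u ≠ v ∧ ¬ G.Adj u v ∧ l ≤ G.degree u + G.degree v ∧ H = G ⊔ SimpleGraph.edge u v

/-- `H` is obtained from `G` by successively joining nonadjacent pairs with degree sum at least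
`l`, until no such pair exists. -/
def IsClosureOf {V : Type*} [Fintype V] (l : ℕ) (G H : SimpleGraph V) : Prop :=
  Relation.ReflTransGen (ClosureStep l) G H ∧ ∀ H', ¬ ClosureStep l H H'

theorem exists_isClosureOf {V : Type*} [Fintype V] (l : ℕ) (G : SimpleGraph V) :
    ∃ H, IsClosureOf l G H := by
  induction G using WellFoundedGT.induction with
  | ind G ih =>
    by_cases h : ∃ H, ClosureStep l G H
    · obtain ⟨H, hH⟩ := h
      have hlt : H > G := by
        obtain ⟨u, v, huv, hadj, -, rfl⟩ := hH
        exact SimpleGraph.lt_sup_edge _ _ _ huv hadj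
      obtain ⟨K, hK, hK'⟩ := ih H hlt
      exact ⟨K, Relation.ReflTransGen.head hH hK, hK'⟩
    · exact ⟨G, Relation.ReflTransGen.refl, fun H hH => h ⟨H, hH⟩⟩

/-- The result does not depend on the order in which the pairs are joined. -/
theorem IsClosureOf.unique {V : Type*} [Fintype V] {l : ℕ} {G H K : SimpleGraph V}
    (hH : IsClosureOf l G H) (hK : IsClosureOf l G K) : H = K := by
  classical
  have base : ∀ {A B : SimpleGraph V}, Relation.ReflTransGen (ClosureStep l) A B → A ≤ B := by
    intro A B h
    induction h with
    | refl => exact le_rfl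
    | tail _ hs ih =>
      obtain ⟨u, v, -, -, -, rfl⟩ := hs
      exact ih.trans le_sup_left
  have key : ∀ {A B C : SimpleGraph V}, Relation.ReflTransGen (ClosureStep l) A B →
      A ≤ C → (∀ C', ¬ ClosureStep l C C') → B ≤ C := by
    intro A B C h hAC hC
    induction h with
    | refl => exact hAC
    | tail _ hs ih =>
      obtain ⟨u, v, huv, -, hdeg, rfl⟩ := hs
      have hadj : C.Adj u v := by
        by_contra hn
        refine hC _ ⟨u, v, huv, hn, hdeg.trans (Nat.add_le_add ?_ ?_), rfl⟩
        · convert SimpleGraph.degree_le_of_le ih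
        · convert SimpleGraph.degree_le_of_le ih
      refine sup_le ih fun a b hab => ?_
      rw [SimpleGraph.edge_adj] at hab
      rcases hab.1 with ⟨rfl, rfl⟩ | ⟨rfl, rfl⟩
      · exact hadj
      · exact hadj.symm
  exact le_antisymm (key hH.1 (base hK.1) hK.2) (key hK.1 (base hH.1) hH.2)

/-- The `l`-closure `C_l(G)`. -/
noncomputable def lClosure {V : Type*} [Fintype V] (l : ℕ) (G : SimpleGraph V) : SimpleGraph V :=
  Classical.choose (exists_isClosureOf l G)

theorem lClosure_spec {V : Type*} [Fintype V] (l : ℕ) (G : SimpleGraph V) :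
    IsClosureOf l G (lClosure l G) :=
  Classical.choose_spec (exists_isClosureOf l G)

/-- `φ(n,r,q) = C(n-q-1, r) + (q+1) C(q, r-1)`, used for `q + 1 ≤ n` and `1 ≤ r`. -/
def phiOne (n r q : ℕ) : ℕ :=
  (n - q - 1).choose r + (q + 1) * q.choose (r - 1)

/-- `ϕ(n,r,k,q) = C(n-q+2k-4, r) + (q-2k+4) C(q, r-1)`, with the subtractions arranged so that
none of them truncates for `2k - 4 ≤ q ≤ n + 2k - 4` and `1 ≤ r`. -/
def phiTwo (n r k q : ℕ) : ℕ :=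
  (n + 2 * k - 4 - q).choose r + (q + 4 - 2 * k) * q.choose (r - 1)

/-- The disjoint union of `K_{n-δ-1}` and `K_{δ+1}`. -/
abbrev exceptionalUnion (n δ : ℕ) : SimpleGraph (Fin (n - δ - 1) ⊕ Fin (δ + 1)) :=
  SimpleGraph.completeGraph (Fin (n - δ - 1)) ⊕g SimpleGraph.completeGraph (Fin (δ + 1))

/-- `K_δ ∨ (K_{n-2δ-1} + I_{δ+1})`. -/
abbrev exceptionalJoin (n δ : ℕ) :
    SimpleGraph (Fin δ ⊕ (Fin (n - 2 * δ - 1) ⊕ Fin (δ + 1))) :=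
  graphJoin (SimpleGraph.completeGraph (Fin δ))
    (SimpleGraph.completeGraph (Fin (n - 2 * δ - 1)) ⊕g SimpleGraph.emptyGraph (Fin (δ + 1)))

end KFactor

/-
In a subgraph `F ≤ G` with all degrees at most `k` and as many edges as possible, an augmenting
trail between two deficient vertices would contradict maximality.  Hence joining nonadjacent `u`
and `v` with `deg u + deg v ≥ n - 1 + (2k - 3)` creates no `k`-factor where there was none, and `G`
may be replaced by its closure `H` of that order.  Nonadjacent vertices of `H` have a small degree
sum, so if some two of degree greater than `δ` were nonadjacent, then `H` would have many vertices
of degree at most `h` for some `h > δ`.  This bounds `N_r(H)` by a convex function of `h`, and the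
hypothesis excludes the values at both ends of the range of `h`.  Therefore `H` is complete or
split: its vertices of degree `δ` form a set `L` with a common neighbourhood `A` outside `L`, and
the others form a clique.

A maximum subgraph of `H[L]` with degrees at most `k` has total deficiency at most `k |A|`, except
for `k = 1` in the two exceptional graphs.  Edges between `A` and `L` make up for this deficiency,
and the clique outside `L` realises the degrees still missing.
-/

namespace KFactor

open Finset SimpleGraph

open scoped Classical

section Degrees

variable {V : Type*} {F G J N : SimpleGraph V} {k : ℕ} {u v w x y : V}

lemma HasFactor.mono (hGJ : G ≤ J) : HasFactor G k → HasFactor J k :=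
  fun ⟨F, hF, hreg⟩ => ⟨F, hF.trans hGJ, hreg⟩

lemma degree_sup_of_disjoint [Fintype (F.neighborSet w)] [Fintype (N.neighborSet w)]
    [Fintype ((F ⊔ N).neighborSet w)] (h : Disjoint F N) :
    (F ⊔ N).degree w = F.degree w + N.degree w := by
  rw [← card_neighborFinset_eq_degree, neighborFinset_sup_of_disjoint w h, card_disjUnion]
  rfl

/-- `F` together with the edge `uv`. -/
def addEdge (F : SimpleGraph V) (u v : V) : SimpleGraph V := F ⊔ edge u v

/-- The graph obtained from `F` by replacing the edge `xy` by the edge `ux`; this moves one unit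
of degree from `y` to `u`. -/
def shift (F : SimpleGraph V) (u x y : V) : SimpleGraph V := addEdge (F \ edge x y) u x

lemma addEdge_le (hF : F ≤ J) (h : J.Adj u v) : addEdge F u v ≤ J :=
  sup_le hF ((edge_le_iff _).2 (Or.inr h))

lemma shift_le (hF : F ≤ J) (h : J.Adj u x) : shift F u x y ≤ J :=
  addEdge_le (sdiff_le.trans hF) h

lemma shift_adj (hxy : F.Adj x y) (hux : u ≠ x) {a b : V} :
    (shift F u x y).Adj a b ↔ (F.Adj a b ∧ s(a, b) ≠ s(x, y)) ∨ s(a, b) = s(u, x) := by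
  have := hxy.ne
  simp only [shift, addEdge, sup_adj, sdiff_adj, edge_adj, ne_eq, Sym2.eq_iff]
  grind [SimpleGraph.irrefl]

lemma addEdge_sdiff_edge (hxy : F.Adj x y) : addEdge (F \ edge x y) x y = F :=
  sdiff_sup_cancel ((edge_le_iff _).2 (Or.inr hxy))

variable [Fintype V]

lemma hasFactor_iff : HasFactor G k ↔ ∃ F ≤ G, ∀ v, F.degree v = k := by
  refine ⟨fun ⟨F, hF, _, hreg⟩ => ⟨F, hF, fun v => ?_⟩, fun ⟨F, hF, hdeg⟩ => ⟨F, hF, _, hdeg⟩⟩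
  convert hreg v

lemma even_sum_degree (F : SimpleGraph V) : Even (∑ v, F.degree v) := by
  rw [F.sum_degrees_eq_twice_card_edges]
  exact even_two_mul _

lemma HasFactor.even_card_mul (hG : HasFactor G k) : Even (Fintype.card V * k) := by
  obtain ⟨F, -, hdeg⟩ := hasFactor_iff.1 hG
  simpa [hdeg] using even_sum_degree F

lemma degree_edge (huv : u ≠ v) (w : V) :
    (edge u v).degree w = (if w = u then 1 else 0) + (if w = v then 1 else 0) := by
  have hnbr : (edge u v).neighborFinset w =
      (if w = u then {v} else ∅) ∪ (if w = v then {u} else ∅) := by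
    ext z
    simp only [mem_neighborFinset, edge_adj]
    grind
  rw [← card_neighborFinset_eq_degree, hnbr]
  grind

lemma degree_addEdge (huv : u ≠ v) (h : ¬ F.Adj u v) (w : V) :
    (addEdge F u v).degree w =
      F.degree w + (if w = u then 1 else 0) + (if w = v then 1 else 0) := by
  rw [add_assoc, ← degree_edge huv, addEdge]
  convert degree_sup_of_disjoint (F.disjoint_edge.2 h)

lemma degree_shift (hxy : F.Adj x y) (hux : u ≠ x) (h : ¬ F.Adj u x) (w : V) :
    (shift F u x y).degree w + (if w = y then 1 else 0) =
      F.degree w + (if w = u then 1 else 0) := by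
  obtain ⟨F₀, hF₀⟩ : ∃ F₀, F₀ = F \ edge x y := ⟨_, rfl⟩
  have hF : F = addEdge F₀ x y := by rw [hF₀, addEdge_sdiff_edge hxy]
  have hxy₀ : ¬ F₀.Adj x y := by simp [hF₀, edge_adj, hxy.ne]
  have hux₀ : ¬ F₀.Adj u x := fun h' => h (hF ▸ Or.inl h')
  rw [shift, ← hF₀, degree_addEdge hux hux₀, hF, degree_addEdge hxy.ne hxy₀]
  omega

lemma exists_degree_eq_of_trail (hF : F ≤ J) (hux : J.Adj u x) (hux' : ¬ F.Adj u x)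
    (hxy : F.Adj x y) (hyv : J.Adj y v) (hyv' : ¬ F.Adj y v) :
    ∃ F' ≤ J, ∀ w, F'.degree w =
      F.degree w + (if w = u then 1 else 0) + (if w = v then 1 else 0) := by
  have hyu : y ≠ u := fun h => hux' (h ▸ hxy.symm)
  have hnew : ¬ (shift F u x y).Adj y v := by
    rw [shift_adj hxy hux.ne]
    grind [hxy.ne]
  refine ⟨addEdge (shift F u x y) y v, addEdge_le (shift_le hF hux) hyv, fun w => ?_⟩
  have hshift := degree_shift hxy hux.ne hux' w
  rw [degree_addEdge hyv.ne hnew]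
  omega

end Degrees

section Counting

variable {V : Type*} [Fintype V] {F : SimpleGraph V} {k : ℕ} {I S : Finset V}

lemma sum_card_neighborFinset_inter (F : SimpleGraph V) (I S : Finset V) :
    ∑ x ∈ I, #(F.neighborFinset x ∩ S) = ∑ y ∈ S, #(F.neighborFinset y ∩ I) := by
  convert sum_card_bipartiteAbove_eq_sum_card_bipartiteBelow F.Adj (s := I) (t := S) using 3 <;>
  · ext
    simp [bipartiteAbove, bipartiteBelow, and_comm, adj_comm]

lemma card_mul_le_sum_card_inter (hI : ∀ x ∈ I, k ≤ F.degree x)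
    (hIS : ∀ x ∈ I, F.neighborFinset x ⊆ S) :
    #I * k ≤ ∑ y ∈ S, #(F.neighborFinset y ∩ I) := by
  rw [← sum_card_neighborFinset_inter F I S, ← smul_eq_mul]
  refine card_nsmul_le_sum _ _ _ fun x hx => ?_
  rw [inter_eq_left.2 (hIS x hx)]
  exact hI x hx

lemma card_mul_le_of_neighborFinset_subset (hI : ∀ x ∈ I, k ≤ F.degree x)
    (hIS : ∀ x ∈ I, F.neighborFinset x ⊆ S) (hS : ∀ y ∈ S, F.degree y ≤ k) :
    #I * k ≤ #S * k :=
  (card_mul_le_sum_card_inter hI hIS).trans <| sum_le_card_nsmul _ _ _ fun y hy =>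
    (card_le_card inter_subset_left).trans (hS y hy)

lemma neighborFinset_subset_of_card_le (hI : ∀ x ∈ I, k ≤ F.degree x)
    (hIS : ∀ x ∈ I, F.neighborFinset x ⊆ S) (hS : ∀ y ∈ S, F.degree y ≤ k) (hSI : #S ≤ #I) :
    ∀ y ∈ S, F.neighborFinset y ⊆ I := by
  have hle : ∀ y ∈ S, #(F.neighborFinset y ∩ I) ≤ k := fun y hy =>
    (card_le_card inter_subset_left).trans (hS y hy)
  have hsum : ∑ y ∈ S, #(F.neighborFinset y ∩ I) = ∑ _y ∈ S, k := by
    refine le_antisymm (sum_le_sum hle) ?_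
    rw [sum_const, smul_eq_mul]
    exact (Nat.mul_le_mul_right k hSI).trans (card_mul_le_sum_card_inter hI hIS)
  intro y hy
  have hk : #(F.neighborFinset y ∩ I) = k := (sum_eq_sum_iff_of_le hle).1 hsum y hy
  exact inter_eq_left.1 (eq_of_subset_of_card_le inter_subset_left (hk ▸ hS y hy))

end Counting

section BMatching

variable {V : Type*} [Fintype V] {F J : SimpleGraph V} {b : V → ℕ} {k : ℕ} {u v x y : V}

/-- `F` is a maximum simple `b`-matching of `J`: a subgraph in which every vertex `v` has degree
at most `b v`, with the largest possible number of edges (measured by the degree sum). -/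
structure IsMaxBMatching (J : SimpleGraph V) (b : V → ℕ) (F : SimpleGraph V) : Prop where
  le : F ≤ J
  degree_le : ∀ v, F.degree v ≤ b v
  sum_degree_le : ∀ N ≤ J, (∀ v, N.degree v ≤ b v) → ∑ v, N.degree v ≤ ∑ v, F.degree v

/-- `u` and `v`, possibly equal, can both receive one more edge without violating the degree
bounds `b`. -/
def HasRoom (F : SimpleGraph V) (b : V → ℕ) (u v : V) : Prop :=
  ∀ w, F.degree w + (if w = u then 1 else 0) + (if w = v then 1 else 0) ≤ b w

lemma hasRoom_of_ne (hb : ∀ w, F.degree w ≤ b w) (huv : u ≠ v) (hu : F.degree u < b u)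
    (hv : F.degree v < b v) : HasRoom F b u v := fun w => by
  have := hb w
  grind

lemma hasRoom_self (hb : ∀ w, F.degree w ≤ b w) (hu : F.degree u + 2 ≤ b u) :
    HasRoom F b u u := fun w => by
  have := hb w
  grind

lemma HasRoom.left_lt (h : HasRoom F b u v) : F.degree u < b u := by
  have := h u
  grind

lemma HasRoom.right_lt (h : HasRoom F b u v) : F.degree v < b v := by
  have := h v
  grind

lemma exists_hasRoom_of_even (hb : ∀ w, F.degree w ≤ b w) (heven : Even (∑ w, b w))
    (hu : F.degree u < b u) : ∃ v, HasRoom F b u v := by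
  by_contra! h
  have hb_eq : ∀ w, b w = F.degree w + if w = u then 1 else 0 := by
    intro w
    have := hb w
    have hne := fun hne : u ≠ w => mt (hasRoom_of_ne hb hne hu) (h w)
    have hself := mt (hasRoom_self (u := u) hb) (h u)
    grind
  have hsum : ∑ w, b w = ∑ w, F.degree w + 1 := by
    simp [hb_eq, sum_add_distrib]
  have := even_sum_degree F
  grind

lemma exists_isMaxBMatching (J : SimpleGraph V) (b : V → ℕ) : ∃ F, IsMaxBMatching J b F := by
  obtain ⟨F, ⟨hF, hdeg⟩, hmax⟩ := Set.exists_max_image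
    {F : SimpleGraph V | F ≤ J ∧ ∀ v, F.degree v ≤ b v} (fun F => ∑ v, F.degree v)
    (Set.toFinite _) ⟨⊥, bot_le, by simp⟩
  exact ⟨F, hF, hdeg, fun N hN hNdeg => hmax N ⟨hN, hNdeg⟩⟩

namespace IsMaxBMatching

lemma not_hasRoom (hF : IsMaxBMatching J b F) {F' : SimpleGraph V} (hF' : F' ≤ J)
    (hdeg : ∀ w, F'.degree w =
      F.degree w + (if w = u then 1 else 0) + (if w = v then 1 else 0)) :
    ¬ HasRoom F b u v := by
  intro hroom
  have hle := hF.sum_degree_le F' hF' fun w => (hdeg w).le.trans (hroom w)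
  simp [hdeg, sum_add_distrib] at hle

lemma adj_of_hasRoom (hF : IsMaxBMatching J b F) (hroom : HasRoom F b u v) (huv : J.Adj u v) :
    F.Adj u v := by
  by_contra h
  exact hF.not_hasRoom (addEdge_le hF.le huv) (degree_addEdge huv.ne h) hroom

lemma adj_of_trail (hF : IsMaxBMatching J b F) (hroom : HasRoom F b u v) (hux : J.Adj u x)
    (hux' : ¬ F.Adj u x) (hxy : F.Adj x y) (hyv : J.Adj y v) : F.Adj y v := by
  by_contra h
  obtain ⟨F', hF', hdeg⟩ := exists_degree_eq_of_trail hF.le hux hux' hxy hyv h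
  exact hF.not_hasRoom hF' hdeg hroom

end IsMaxBMatching

end BMatching

section Closure

variable {V : Type*} [Fintype V] {G M : SimpleGraph V} {k l : ℕ} {u v w x y z : V}

lemma degree_sdiff_add_degree [Fintype ((G \ M).neighborSet w)] (h : M ≤ G) :
    (G \ M).degree w + M.degree w = G.degree w := by
  simp only [← card_neighborFinset_eq_degree, neighborFinset_sdiff]
  refine card_sdiff_add_card_eq_card fun x hx => ?_
  simpa using h (by simpa using hx)

lemma isMaxBMatching_of_sum_degree_add_two (hno : ¬ HasFactor G k) (hM : M ≤ G)
    (hle : ∀ w, M.degree w ≤ k) (hsum : ∑ w, M.degree w + 2 = Fintype.card V * k) :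
    IsMaxBMatching G (fun _ => k) M where
  le := hM
  degree_le := hle
  sum_degree_le N hN hNk := by
    by_contra! hlt
    have hNsum : ∑ w, N.degree w = ∑ _w : V, k := by
      refine le_antisymm (sum_le_sum fun w _ => hNk w) ?_
      simp only [sum_const, card_univ, smul_eq_mul]
      have := even_sum_degree M
      have := even_sum_degree N
      grind
    exact hno <| hasFactor_iff.2
      ⟨N, hN, fun w => (sum_eq_sum_iff_of_le fun w _ => hNk w).1 hNsum w (mem_univ w)⟩

/-- `M` is a `k`-factor of `G` up to one missing edge: its degrees are `k`, except for two
vertices `u`, `v`, nonadjacent in `G`, of degree `k - 1`. -/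
structure IsNearFactor (G : SimpleGraph V) (k : ℕ) (M : SimpleGraph V) (u v : V) : Prop where
  le : M ≤ G
  ne : u ≠ v
  not_adj : ¬ G.Adj u v
  degree_add : ∀ w, M.degree w + (if w = u then 1 else 0) + (if w = v then 1 else 0) = k

namespace IsNearFactor

lemma symm (hM : IsNearFactor G k M u v) : IsNearFactor G k M v u where
  le := hM.le
  ne := hM.ne.symm
  not_adj h := hM.not_adj h.symm
  degree_add w := by rw [← hM.degree_add w, add_right_comm]

lemma degree_eq (hM : IsNearFactor G k M u v) (hu : w ≠ u) (hv : w ≠ v) : M.degree w = k := by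
  simpa [hu, hv] using hM.degree_add w

lemma degree_left (hM : IsNearFactor G k M u v) : M.degree u + 1 = k := by
  simpa [hM.ne] using hM.degree_add u

lemma degree_right (hM : IsNearFactor G k M u v) : M.degree v + 1 = k := hM.symm.degree_left

lemma degree_le (hM : IsNearFactor G k M u v) (w : V) : M.degree w ≤ k := by
  have := hM.degree_add w
  omega

lemma hasRoom (hM : IsNearFactor G k M u v) : HasRoom M (fun _ => k) u v := fun w =>
  (hM.degree_add w).le

lemma sum_degree_add_two (hM : IsNearFactor G k M u v) :
    ∑ w, M.degree w + 2 = Fintype.card V * k := by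
  have h := Finset.sum_congr rfl fun w (_ : w ∈ univ) => hM.degree_add w
  simpa [sum_add_distrib, add_assoc] using h

lemma not_adj_of_sdiff_adj (hM : IsNearFactor G k M u v)
    (hmax : IsMaxBMatching G (fun _ => k) M) (hx : (G \ M).Adj u x) (hy : (G \ M).Adj v y) :
    ¬ M.Adj x y := fun hxy =>
  hy.2 (hmax.adj_of_trail hM.hasRoom hx.1 hx.2 hxy hy.1.symm).symm

lemma card_compl_union_le_card_inter (hM : IsNearFactor G k M u v)
    (hdeg : Fintype.card V - 1 + (2 * k - 3) ≤ G.degree u + G.degree v) :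
    #({u, v} ∪ ((G \ M).neighborFinset u ∪ (G \ M).neighborFinset v))ᶜ + (if k = 1 then 1 else 0) ≤
      #((G \ M).neighborFinset u ∩ (G \ M).neighborFinset v) := by
  have hdisj : Disjoint {u, v} ((G \ M).neighborFinset u ∪ (G \ M).neighborFinset v) := by
    rw [Finset.disjoint_left]
    simp only [mem_insert, mem_singleton, mem_union, mem_neighborFinset]
    rintro _ (rfl | rfl)
    · simpa using fun h => absurd h.symm hM.not_adj
    · simpa using fun h => absurd h hM.not_adj
  have hcompl := card_compl_add_card
    ({u, v} ∪ ((G \ M).neighborFinset u ∪ (G \ M).neighborFinset v))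
  rw [card_union_of_disjoint hdisj, card_pair hM.ne] at hcompl
  have hunion := card_union_add_card_inter ((G \ M).neighborFinset u) ((G \ M).neighborFinset v)
  simp only [card_neighborFinset_eq_degree] at hunion
  have hu := degree_sdiff_add_degree (w := u) hM.le
  have hv := degree_sdiff_add_degree (w := v) hM.le
  have := hM.degree_left
  have := hM.degree_right
  split_ifs <;> omega

/- The set `I` of vertices that can be joined to both `u` and `v` is at least as large as the set
`S` of vertices that can be joined to neither, and all `M`-neighbours of `I` lie in `S`. -/
lemma two_le_and_neighborFinset_subset (hM : IsNearFactor G k M u v)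
    (hmax : IsMaxBMatching G (fun _ => k) M)
    (hdeg : Fintype.card V - 1 + (2 * k - 3) ≤ G.degree u + G.degree v) :
    2 ≤ k ∧ ∀ y, y ≠ u → y ≠ v → ¬ (G \ M).Adj u y → ¬ (G \ M).Adj v y →
      ∀ z, M.Adj y z → (G \ M).Adj u z ∧ (G \ M).Adj v z := by
  set I := (G \ M).neighborFinset u ∩ (G \ M).neighborFinset v with hI
  set S := ({u, v} ∪ ((G \ M).neighborFinset u ∪ (G \ M).neighborFinset v))ᶜ with hS
  have memI : ∀ x, x ∈ I ↔ (G \ M).Adj u x ∧ (G \ M).Adj v x := fun x => by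
    rw [hI, mem_inter, mem_neighborFinset, mem_neighborFinset]
  have memS : ∀ x, x ∈ S ↔ x ≠ u ∧ x ≠ v ∧ ¬ (G \ M).Adj u x ∧ ¬ (G \ M).Adj v x := fun x => by
    rw [hS, mem_compl, mem_union, mem_union, mem_neighborFinset, mem_neighborFinset, mem_insert,
      mem_singleton]
    tauto
  have hSI := hM.card_compl_union_le_card_inter hdeg
  rw [← hI, ← hS] at hSI
  have hIdeg : ∀ x ∈ I, k ≤ M.degree x := fun x hx => by
    obtain ⟨hu, hv⟩ := (memI x).1 hx
    exact (hM.degree_eq hu.ne' hv.ne').ge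
  have hIS : ∀ x ∈ I, M.neighborFinset x ⊆ S := fun x hx y hy => by
    obtain ⟨hu, hv⟩ := (memI x).1 hx
    have hxy : M.Adj x y := (M.mem_neighborFinset x y).1 hy
    exact (memS y).2 ⟨fun h => hu.2 (h ▸ hxy.symm), fun h => hv.2 (h ▸ hxy.symm),
      fun h => hM.not_adj_of_sdiff_adj hmax h hv hxy.symm,
      fun h => hM.not_adj_of_sdiff_adj hmax hu h hxy⟩
  have hSdeg : ∀ y ∈ S, M.degree y ≤ k := fun y _ => hM.degree_le y
  have hk := hM.degree_left
  refine ⟨?_, fun y hyu hyv hyu' hyv' z hyz => ?_⟩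
  · by_contra! h
    have hle := card_mul_le_of_neighborFinset_subset hIdeg hIS hSdeg
    obtain rfl : k = 1 := by omega
    simp only [mul_one, if_true] at hle hSI
    omega
  · exact (memI z).1 <| neighborFinset_subset_of_card_le hIdeg hIS hSdeg (by omega) y
      ((memS y).2 ⟨hyu, hyv, hyu', hyv'⟩) ((M.mem_neighborFinset y z).2 hyz)

lemma sdiff_adj_of_adj (hM : IsNearFactor G k M u v) (hmax : IsMaxBMatching G (fun _ => k) M)
    (hdeg : Fintype.card V - 1 + (2 * k - 3) ≤ G.degree u + G.degree v) (huz : M.Adj u z) :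
    (G \ M).Adj v z := by
  by_contra hvz
  have hzv : z ≠ v := fun h => hM.not_adj (h ▸ hM.le huz)
  have huu := (hM.two_le_and_neighborFinset_subset hmax hdeg).2 z huz.ne' hzv
    (fun h => h.2 huz) hvz u huz.symm
  exact huu.1.ne rfl

lemma exists_adj_adj_sdiff_adj (hM : IsNearFactor G k M u v)
    (hmax : IsMaxBMatching G (fun _ => k) M)
    (hdeg : Fintype.card V - 1 + (2 * k - 3) ≤ G.degree u + G.degree v) :
    ∃ w t, M.Adj v w ∧ M.Adj w t ∧ (G \ M).Adj u w ∧ (G \ M).Adj u t := by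
  obtain ⟨hk, hS⟩ := hM.two_le_and_neighborFinset_subset hmax hdeg
  have hv := hM.degree_right
  obtain ⟨w, hvw⟩ := (M.degree_pos_iff_exists_adj v).1 (by omega)
  have huw : (G \ M).Adj u w := hM.symm.sdiff_adj_of_adj hmax (by omega) hvw
  have hw : 1 < #(M.neighborFinset w) := by
    rwa [card_neighborFinset_eq_degree, hM.degree_eq huw.ne' hvw.ne']
  obtain ⟨t, ht, htv⟩ := exists_mem_ne hw v
  have hwt : M.Adj w t := (M.mem_neighborFinset w t).1 ht
  refine ⟨w, t, hvw, hwt, huw, ?_⟩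
  by_contra hut
  have htu : t ≠ u := fun h => huw.2 (h ▸ hwt.symm)
  exact (hS t htu htv hut (fun h => hM.not_adj_of_sdiff_adj hmax huw h hwt) w hwt.symm).2.2 hvw

lemma isMaxBMatching_shift (hM : IsNearFactor G k M u v) (hno : ¬ HasFactor G k)
    (huz : M.Adj u z) (hvz : (G \ M).Adj v z) :
    IsMaxBMatching G (fun _ => k) (shift M v z u) := by
  have hshift := degree_shift huz.symm hvz.ne hvz.2
  refine isMaxBMatching_of_sum_degree_add_two hno (shift_le hM.le hvz.1) (fun w => ?_) ?_
  · have := hshift w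
    have := hM.degree_add w
    omega
  · have hsum := Finset.sum_congr rfl fun w (_ : w ∈ univ) => hshift w
    simp only [sum_add_distrib, sum_ite_eq', mem_univ, if_true] at hsum
    have := hM.sum_degree_add_two
    omega

/- Moving an edge `uz` of `M` to `vz` leaves room for two edges at `u`, and `u t w u` is then an
augmenting trail. -/
theorem hasFactor (hM : IsNearFactor G k M u v)
    (hdeg : Fintype.card V - 1 + (2 * k - 3) ≤ G.degree u + G.degree v) : HasFactor G k := by
  by_contra hno
  have hmax := isMaxBMatching_of_sum_degree_add_two hno hM.le hM.degree_le hM.sum_degree_add_two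
  obtain ⟨hk, -⟩ := hM.two_le_and_neighborFinset_subset hmax hdeg
  have hu := hM.degree_left
  obtain ⟨z, huz⟩ := (M.degree_pos_iff_exists_adj u).1 (by omega)
  have hvz : (G \ M).Adj v z := hM.sdiff_adj_of_adj hmax hdeg huz
  obtain ⟨w, t, hvw, hwt, huw, hut⟩ := hM.exists_adj_adj_sdiff_adj hmax hdeg
  have hmax' := hM.isMaxBMatching_shift hno huz hvz
  have hroom : HasRoom (shift M v z u) (fun _ => k) u u := by
    refine hasRoom_self hmax'.degree_le ?_
    have := degree_shift huz.symm hvz.ne hvz.2 u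
    simp only [if_true, hM.ne, if_false] at this
    omega
  have hadj := fun a b => shift_adj (a := a) (b := b) huz.symm hvz.ne
  have hut' : ¬ (shift M v z u).Adj u t := by
    rw [hadj, Sym2.eq_iff]
    rintro (⟨h, -⟩ | ⟨h, -⟩ | ⟨h, -⟩)
    exacts [hut.2 h, hM.ne h, huz.ne h]
  have htw : (shift M v z u).Adj t w := by
    refine (hadj t w).2 (Or.inl ⟨hwt.symm, ?_⟩)
    rw [Ne, Sym2.eq_iff]
    rintro (⟨-, h⟩ | ⟨h, -⟩)
    exacts [huw.ne' h, hut.ne' h]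
  have hwu := hmax'.adj_of_trail hroom hut.1 hut' htw huw.1.symm
  rw [hadj, Sym2.eq_iff] at hwu
  rcases hwu with ⟨h, -⟩ | ⟨h, -⟩ | ⟨-, h⟩
  exacts [huw.2 h.symm, hvw.ne' h, hM.ne h]

end IsNearFactor

lemma hasFactor_of_sup_edge (huv : u ≠ v) (hnadj : ¬ G.Adj u v)
    (hdeg : Fintype.card V - 1 + (2 * k - 3) ≤ G.degree u + G.degree v)
    (hG : HasFactor (G ⊔ edge u v) k) : HasFactor G k := by
  obtain ⟨F, hF, hFdeg⟩ := hasFactor_iff.1 hG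
  have hle : F \ edge u v ≤ G := sdiff_le_iff.2 (hF.trans_eq (sup_comm _ _))
  by_cases hFuv : F.Adj u v
  · have hF₀ := addEdge_sdiff_edge hFuv
    have hFuv₀ : ¬ (F \ edge u v).Adj u v := by simp [edge_adj, huv]
    generalize F \ edge u v = M at hle hF₀ hFuv₀
    subst hF₀
    have hM : IsNearFactor G k M u v :=
      ⟨hle, huv, hnadj, fun w => (degree_addEdge huv hFuv₀ w).symm.trans (hFdeg w)⟩
    exact hM.hasFactor hdeg
  · rw [F.sdiff_edge hFuv] at hle
    exact hasFactor_iff.2 ⟨F, hle, hFdeg⟩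

/- The truncated `2 * k - 3` is `0` for `k = 1`, so the two cases of the theorem, the closures of
order `n - 1` for `k = 1` and `n + 2k - 4` for `k ≥ 2`, are treated at once. -/
theorem hasFactor_of_lClosure
    (hG : HasFactor (lClosure (Fintype.card V - 1 + (2 * k - 3)) G) k) : HasFactor G k := by
  refine Relation.ReflTransGen.head_induction_on
    (motive := fun H _ => HasFactor H k) (lClosure_spec _ G).1 hG ?_
  rintro _ _ ⟨u, v, huv, hnadj, hdeg, rfl⟩ - hfactor
  exact hasFactor_of_sup_edge huv hnadj hdeg hfactor

lemma le_lClosure (l : ℕ) (G : SimpleGraph V) : G ≤ lClosure l G := by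
  refine Relation.ReflTransGen.head_induction_on
    (motive := fun H _ => H ≤ lClosure l G) (lClosure_spec l G).1 le_rfl ?_
  rintro _ _ ⟨u, v, -, -, -, rfl⟩ - hle
  exact le_sup_left.trans hle

lemma degree_add_degree_lClosure_lt (huv : u ≠ v) (hnadj : ¬ (lClosure l G).Adj u v) :
    (lClosure l G).degree u + (lClosure l G).degree v < l := by
  by_contra! hl
  exact (lClosure_spec l G).2 _ ⟨u, v, huv, hnadj, hl, rfl⟩

end Closure

section DegreeSequence

variable {V : Type*} [Fintype V] {F H N : SimpleGraph V} {b g : V → ℕ} {k : ℕ} {u v p q : V}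
  {A B L : Finset V}

lemma exists_adj_not_adj_of_degree_lt (h : F.degree p < F.degree q) :
    ∃ x, F.Adj q x ∧ ¬ F.Adj p x := by
  simpa using exists_mem_notMem_of_card_lt_card h

lemma IsMaxBMatching.card_pair_union_add_two_le (hN : IsMaxBMatching ⊤ b N) (hb : ∀ v, b v ≤ k)
    (hroom : HasRoom N b u v) :
    #({u, v} ∪ (N.neighborFinset u ∪ N.neighborFinset v)) + 2 ≤ 2 * k := by
  have hu := hroom.left_lt.trans_le (hb u)
  have hv := hroom.right_lt.trans_le (hb v)
  have hunion := card_union_le (N.neighborFinset u) (N.neighborFinset v)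
  rcases eq_or_ne u v with rfl | huv
  · have hinsert := card_insert_le u (N.neighborFinset u)
    have := hroom u
    have := hb u
    simp only [pair_eq_singleton, union_self, ← insert_eq, card_neighborFinset_eq_degree,
      if_true] at *
    omega
  · have hadj := hN.adj_of_hasRoom hroom ((top_adj u v).2 huv)
    have hsub : {u, v} ⊆ N.neighborFinset u ∪ N.neighborFinset v := by
      simp [insert_subset_iff, hadj, hadj.symm]
    rw [union_eq_right.2 hsub]
    simp only [card_neighborFinset_eq_degree] at hunion
    omega

theorem exists_degree_eq_of_even (hb : ∀ v, b v ≤ k) (hB : ∀ v ∈ B, b v = k)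
    (hcard : 2 * k ≤ #B + 1) (heven : Even (∑ v, b v)) :
    ∃ N : SimpleGraph V, ∀ v, N.degree v = b v := by
  obtain ⟨N, hN⟩ := exists_isMaxBMatching ⊤ b
  refine ⟨N, fun u => (hN.degree_le u).antisymm ?_⟩
  by_contra! hu
  obtain ⟨v, hroom⟩ := exists_hasRoom_of_even hN.degree_le heven hu
  obtain ⟨y, hyB, hy⟩ : ∃ y ∈ B, y ∉ {u, v} ∪ (N.neighborFinset u ∪ N.neighborFinset v) := by
    refine exists_mem_notMem_of_card_lt_card ?_
    have := hN.card_pair_union_add_two_le hb hroom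
    omega
  simp only [mem_union, mem_insert, mem_singleton, mem_neighborFinset, not_or] at hy
  obtain ⟨⟨hyu, hyv⟩, huy, hvy⟩ := hy
  have hy_deg : N.degree y = k := by
    refine ((hN.degree_le y).trans (hb y)).antisymm ?_
    by_contra! hlt
    rw [← hB y hyB] at hlt
    exact huy <| hN.adj_of_hasRoom (hasRoom_of_ne hN.degree_le (Ne.symm hyu) hu hlt)
      ((top_adj u y).2 (Ne.symm hyu))
  obtain ⟨x, hyx, hux⟩ :=
    exists_adj_not_adj_of_degree_lt ((hu.trans_le (hb u)).trans_eq hy_deg.symm)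
  have hxu : u ≠ x := fun h => huy (h ▸ hyx.symm)
  exact hvy (hN.adj_of_trail hroom ((top_adj u x).2 hxu) hux hyx.symm ((top_adj y v).2 hyv)).symm

lemma hasFactor_top (hcard : 2 * k ≤ Fintype.card V + 1) (heven : Even (Fintype.card V * k)) :
    HasFactor (⊤ : SimpleGraph V) k := by
  obtain ⟨N, hN⟩ := exists_degree_eq_of_even (b := fun _ : V => k) (B := univ) (fun _ => le_rfl)
    (fun _ _ => rfl) (by simpa using hcard) (by simpa using heven)
  exact hasFactor_iff.2 ⟨N, le_top, hN⟩

theorem exists_le_between_degree_eq (hAL : ∀ a ∈ A, ∀ x ∈ L, H.Adj a x)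
    (hg : ∀ x ∈ L, g x ≤ #A) (hsum : ∑ x ∈ L, g x ≤ k * #A) :
    ∃ N ≤ H.between A L, (∀ x ∈ L, N.degree x = g x) ∧ ∀ a ∈ A, N.degree a ≤ k := by
  have hdisj : Disjoint (A : Set V) L :=
    Set.disjoint_left.2 fun a ha ha' => (hAL a ha a ha').ne rfl
  have hnotMem : ∀ a ∈ A, a ∉ L := fun a ha ha' => Set.disjoint_left.1 hdisj ha ha'
  have hJ : ∀ a ∈ A, ∀ x ∈ L, (H.between A L).Adj a x := fun a ha x hx =>
    ⟨hAL a ha x hx, Or.inl ⟨ha, hx⟩⟩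
  obtain ⟨N, hN⟩ := exists_isMaxBMatching (H.between A L) fun v => if v ∈ L then g v else k
  have hN_L : ∀ x ∈ L, N.degree x ≤ g x := fun x hx => by simpa [hx] using hN.degree_le x
  have hN_A : ∀ a ∈ A, N.degree a ≤ k := fun a ha => by
    simpa [hnotMem a ha] using hN.degree_le a
  have hbip : N.IsBipartiteWith A L :=
    ⟨hdisj, fun _ _ h => (between_isBipartiteWith hdisj).mem_of_adj (hN.le h)⟩
  refine ⟨N, hN.le, fun u hu => (hN_L u hu).antisymm ?_, hN_A⟩
  by_contra! hlt
  have hroom : ∀ a ∈ A, N.degree a < k → HasRoom N (fun v => if v ∈ L then g v else k) u a :=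
    fun a ha hak => hasRoom_of_ne hN.degree_le (hJ a ha u hu).ne' (by simpa [hu] using hlt)
      (by simpa [hnotMem a ha] using hak)
  obtain ⟨q, hqA, hq⟩ : ∃ q ∈ A, N.degree q < k := by
    refine exists_lt_of_sum_lt ?_
    calc ∑ a ∈ A, N.degree a = ∑ x ∈ L, N.degree x := isBipartiteWith_sum_degrees_eq hbip
      _ < ∑ x ∈ L, g x := sum_lt_sum hN_L ⟨u, hu, hlt⟩
      _ ≤ ∑ _a ∈ A, k := by simpa [mul_comm] using hsum
  obtain ⟨p, hpA, hup⟩ : ∃ p ∈ A, p ∉ N.neighborFinset u :=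
    exists_mem_notMem_of_card_lt_card (hlt.trans_le (hg u hu))
  rw [mem_neighborFinset] at hup
  have hp : k ≤ N.degree p := by
    by_contra! hp
    exact hup (hN.adj_of_hasRoom (hroom p hpA hp) (hJ p hpA u hu).symm)
  obtain ⟨x, hpx, hqx⟩ := exists_adj_not_adj_of_degree_lt (hq.trans_le hp)
  have hxL : x ∈ L := hbip.mem_of_mem_adj hpA hpx
  exact hqx (hN.adj_of_trail (hroom q hqA hq) (hJ p hpA u hu).symm hup hpx
    (hJ q hqA x hxL).symm).symm

end DegreeSequence

section Deficiency

variable {V : Type*} [Fintype V] {F H : SimpleGraph V} {a k m : ℕ} {u v x y : V} {L : Finset V}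

lemma sum_tsub_degree_eq (F : SimpleGraph V) (L : Finset V) (k : ℕ) :
    ∑ x ∈ L, (k - F.degree x) = ∑ x ∈ L with F.degree x < k, (k - F.degree x) := by
  refine (sum_filter_of_ne fun x _ hx => ?_).symm
  omega

namespace IsMaxBMatching

lemma degree_le_of_mem (hF : IsMaxBMatching H (fun v => if v ∈ L then k else 0) F) (hx : x ∈ L) :
    F.degree x ≤ k := by
  simpa [hx] using hF.degree_le x

lemma degree_eq_zero_of_notMem (hF : IsMaxBMatching H (fun v => if v ∈ L then k else 0) F)
    (hx : x ∉ L) : F.degree x = 0 := by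
  simpa [hx] using hF.degree_le x

lemma mem_of_adj (hF : IsMaxBMatching H (fun v => if v ∈ L then k else 0) F) (hxy : F.Adj x y) :
    y ∈ L := by
  by_contra hy
  exact (F.degree_pos_iff_exists_adj y).2 ⟨x, hxy.symm⟩ |>.ne' (hF.degree_eq_zero_of_notMem hy)

lemma hasRoom_of_mem (hF : IsMaxBMatching H (fun v => if v ∈ L then k else 0) F) (hu : u ∈ L)
    (hv : v ∈ L) (huv : u ≠ v) (hu' : F.degree u < k) (hv' : F.degree v < k) :
    HasRoom F (fun v => if v ∈ L then k else 0) u v :=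
  hasRoom_of_ne hF.degree_le huv (by simpa [hu]) (by simpa [hv])

lemma filter_subset_union (hF : IsMaxBMatching H (fun v => if v ∈ L then k else 0) F)
    (hu : u ∈ L) (hu' : F.degree u < k) :
    {v ∈ L | F.degree v < k} ⊆
      F.neighborFinset u ∩ {v ∈ L | F.degree v < k} ∪ L \ H.neighborFinset u := by
  intro v hv
  obtain ⟨hvL, hv'⟩ := mem_filter.1 hv
  by_cases huv : H.Adj u v
  · have hadj := hF.adj_of_hasRoom (hF.hasRoom_of_mem hu hvL huv.ne hu' hv') huv
    exact mem_union_left _ (mem_inter.2 ⟨(F.mem_neighborFinset u v).2 hadj, hv⟩)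
  · exact mem_union_right _ (by simp [hvL, huv])

/- The deficient vertices form a clique of `F` up to `m - 1` missing neighbours each, so each of
them has at least `e` deficient `F`-neighbours, where `e + m` bounds their number. -/
lemma sum_deficiency_le (hF : IsMaxBMatching H (fun v => if v ∈ L then k else 0) F)
    (hm : ∀ x ∈ L, #(L \ H.neighborFinset x) ≤ m) (hdef : ∑ x ∈ L, (k - F.degree x) ≠ 0) :
    ∃ e < k, ∑ x ∈ L, (k - F.degree x) ≤ (e + m) * (k - e) := by
  set U := {x ∈ L | F.degree x < k} with hU
  have memU : ∀ x, x ∈ U ↔ x ∈ L ∧ F.degree x < k := fun x => mem_filter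
  rw [sum_tsub_degree_eq] at hdef ⊢
  obtain ⟨u, huU, hmin⟩ := U.exists_min_image (fun x => #(F.neighborFinset x ∩ U))
    (nonempty_of_sum_ne_zero hdef)
  obtain ⟨huL, hu⟩ := (memU u).1 huU
  have hle : ∀ x, #(F.neighborFinset x ∩ U) ≤ F.degree x := fun x => card_le_card inter_subset_left
  have hcard : #U ≤ #(F.neighborFinset u ∩ U) + m :=
    (card_le_card (hF.filter_subset_union huL hu)).trans <|
      (card_union_le _ _).trans (Nat.add_le_add_left (hm u huL) _)
  refine ⟨#(F.neighborFinset u ∩ U), (hle u).trans_lt hu, ?_⟩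
  calc ∑ x ∈ U, (k - F.degree x) ≤ #U * (k - #(F.neighborFinset u ∩ U)) :=
        sum_le_card_nsmul _ _ _ fun x hx => Nat.sub_le_sub_left ((hmin x hx).trans (hle x)) k
    _ ≤ _ := Nat.mul_le_mul_right _ hcard

lemma degree_pos_of_isClique (hF : IsMaxBMatching H (fun v => if v ∈ L then k else 0) F)
    (hk : 2 ≤ k) (hL : H.IsClique L) (hcard : 1 < #L) (hx : x ∈ L) : 0 < F.degree x := by
  by_contra! hx0
  have hiso : ∀ y, ¬ F.Adj x y := not_exists.1 (mt (F.degree_pos_iff_exists_adj x).2 hx0.not_gt)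
  obtain ⟨y, hyL, hyx⟩ := exists_mem_ne hcard x
  have hxy : H.Adj x y := hL hx hyL hyx.symm
  obtain ⟨z, hyz⟩ : ∃ z, F.Adj y z := by
    rw [← degree_pos_iff_exists_adj]
    by_contra! hy0
    exact hiso y (hF.adj_of_hasRoom (hF.hasRoom_of_mem hx hyL hyx.symm (by omega) (by omega)) hxy)
  have hzx : z ≠ x := fun h => hiso y (h ▸ hyz.symm)
  have hroom : HasRoom F (fun v => if v ∈ L then k else 0) x x :=
    hasRoom_self hF.degree_le (by rw [if_pos hx]; omega)
  exact hiso z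
    (hF.adj_of_trail hroom hxy (hiso y) hyz (hL (hF.mem_of_adj hyz) hx hzx)).symm

lemma sum_deficiency_le_of_two_le (hF : IsMaxBMatching H (fun v => if v ∈ L then k else 0) F)
    (hk : 2 ≤ k) (hm : ∀ x ∈ L, #(L \ H.neighborFinset x) ≤ m) (hm0 : 1 ≤ m) :
    ∑ x ∈ L, (k - F.degree x) ≤ k * (m + 2 * k - 4) := by
  by_cases hdef : ∑ x ∈ L, (k - F.degree x) = 0
  · exact hdef.trans_le (Nat.zero_le _)
  obtain ⟨e, hek, hle⟩ := hF.sum_deficiency_le hm hdef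
  refine hle.trans ?_
  obtain ⟨j, rfl⟩ := Nat.exists_eq_add_of_lt hek
  obtain ⟨m, rfl⟩ := Nat.exists_eq_add_of_le' hm0
  have h1 : e + j + 1 - e = j + 1 := by omega
  have h2 : m + 1 + 2 * (e + j + 1) - 4 + 1 = m + 2 * (e + j) := by omega
  generalize m + 1 + 2 * (e + j + 1) - 4 = a at h2 ⊢
  rw [h1]
  nlinarith [mul_nonneg (Nat.zero_le e) (Nat.zero_le j)]

lemma deficiency_le_of_two_le (hF : IsMaxBMatching H (fun v => if v ∈ L then k else 0) F)
    (hk : 2 ≤ k) (hm : ∀ x ∈ L, #(L \ H.neighborFinset x) ≤ m) (hcard : 1 < #L) (hx : x ∈ L) :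
    k - F.degree x ≤ m + 2 * k - 4 := by
  have hm0 : 0 < m := (card_pos.2 ⟨x, by simp [hx]⟩).trans_le (hm x hx)
  by_cases hkm : k ≤ m + 2 * k - 4
  · omega
  have hL : H.IsClique L := by
    intro y hy z hz hyz
    by_contra hadj
    have hpair : {y, z} ⊆ L \ H.neighborFinset y := by
      simp_all [insert_subset_iff]
    have := (card_le_card hpair).trans (hm y hy)
    rw [card_pair hyz] at this
    omega
  have := hF.degree_pos_of_isClique hk hL hcard hx
  omega

lemma sum_degree_eq_sum_mem (hF : IsMaxBMatching H (fun v => if v ∈ L then k else 0) F) :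
    ∑ x ∈ L, F.degree x = ∑ x, F.degree x :=
  sum_subset (subset_univ L) fun _ _ hx => hF.degree_eq_zero_of_notMem hx

/- If `a + 1` vertices of `L` were unmatched, they would be adjacent to all others, and a matched
pair of those others would extend to an augmenting trail between two unmatched vertices. -/
lemma card_unmatched_ne (hF : IsMaxBMatching H (fun v => if v ∈ L then 1 else 0) F)
    (hm : ∀ x ∈ L, #(L \ H.neighborFinset x) ≤ a + 1) (ha : 0 < a) (hcard : a + 1 < #L) :
    #{x ∈ L | F.degree x < 1} ≠ a + 1 := by
  set U := {x ∈ L | F.degree x < 1}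
  have memU : ∀ x, x ∈ U ↔ x ∈ L ∧ F.degree x < 1 := fun x => mem_filter
  intro hU_card
  have hiso : ∀ u ∈ U, ∀ x, ¬ F.Adj u x := fun u hu x hux => by
    have := ((memU u).1 hu).2
    have := (F.degree_pos_iff_exists_adj u).2 ⟨x, hux⟩
    omega
  have hadj : ∀ u ∈ U, ∀ x ∈ L, x ∉ U → H.Adj u x := by
    intro u hu x hx hxU
    obtain ⟨huL, hu'⟩ := (memU u).1 hu
    have hsub : U ⊆ L \ H.neighborFinset u := by
      refine (hF.filter_subset_union huL hu').trans (union_subset (fun y hy => ?_) Subset.rfl)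
      exact absurd ((F.mem_neighborFinset u y).1 (mem_inter.1 hy).1) (hiso u hu y)
    have heq := eq_of_subset_of_card_le hsub ((hm u huL).trans hU_card.ge)
    by_contra hux
    exact hxU (heq ▸ mem_sdiff.2 ⟨hx, mt (H.mem_neighborFinset u x).1 hux⟩)
  obtain ⟨u, hu, v, hv, huv⟩ := one_lt_card.1 (show 1 < #U by omega)
  obtain ⟨x, hxL, hxU⟩ := exists_mem_notMem_of_card_lt_card (hU_card ▸ hcard)
  obtain ⟨y, hxy⟩ := (F.degree_pos_iff_exists_adj x).1
    (by by_contra! h; exact hxU ((memU x).2 ⟨hxL, by omega⟩))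
  have hyL := hF.mem_of_adj hxy
  have hyU : y ∉ U := fun hy => hiso y hy x hxy.symm
  obtain ⟨huL, hu'⟩ := (memU u).1 hu
  obtain ⟨hvL, hv'⟩ := (memU v).1 hv
  exact hiso v hv y (hF.adj_of_trail (hF.hasRoom_of_mem huL hvL huv hu' hv')
    (hadj u hu x hxL hxU) (hiso u hu x) hxy (hadj v hv y hyL hyU).symm).symm

lemma sum_deficiency_le_of_eq_one (hF : IsMaxBMatching H (fun v => if v ∈ L then 1 else 0) F)
    (hm : ∀ x ∈ L, #(L \ H.neighborFinset x) ≤ a + 1) (heven : a = 0 → Even #L)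
    (hcard : 0 < a → a + 1 < #L) : ∑ x ∈ L, (1 - F.degree x) ≤ a := by
  by_contra! hlt
  obtain ⟨e, he, hle⟩ := hF.sum_deficiency_le hm (by omega)
  obtain rfl : e = 0 := by omega
  have hD : ∑ x ∈ L, (1 - F.degree x) = a + 1 := by omega
  rcases Nat.eq_zero_or_pos a with rfl | ha
  · have hsum : ∑ x ∈ L, (1 - F.degree x) + ∑ x, F.degree x = #L := by
      rw [← hF.sum_degree_eq_sum_mem, ← sum_add_distrib, card_eq_sum_ones]
      exact sum_congr rfl fun x hx => Nat.sub_add_cancel (hF.degree_le_of_mem hx)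
    have := even_sum_degree F
    have := heven rfl
    grind
  · refine hF.card_unmatched_ne hm ha (hcard ha) ?_
    rw [← hD, sum_tsub_degree_eq, card_eq_sum_ones]
    refine sum_congr rfl fun x hx => ?_
    have := (mem_filter.1 hx).2
    omega

end IsMaxBMatching

end Deficiency

section Split

variable {V : Type*} [Fintype V] {F H : SimpleGraph V} {d δ k s : ℕ} {v x : V} {A L : Finset V}

/-- A split graph with clique `Lᶜ` and a side `L` of `s` vertices of degree `d` that all have the
same neighbours outside `L`, namely `A`. Nothing is required of the edges inside `L`. -/
structure IsSplit (H : SimpleGraph V) (d s : ℕ) (A L : Finset V) : Prop where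
  disjoint : Disjoint A L
  isClique : H.IsClique (L : Set V)ᶜ
  adj_iff : ∀ v ∉ L, ∀ x ∈ L, (H.Adj v x ↔ v ∈ A)
  degree_eq : ∀ x ∈ L, H.degree x = d
  card_eq : #L = s

namespace IsSplit

lemma adj (hS : IsSplit H d s A L) (hv : v ∈ A) (hx : x ∈ L) : H.Adj v x :=
  (hS.adj_iff v (disjoint_left.1 hS.disjoint hv) x hx).2 hv

lemma neighborFinset_sdiff (hS : IsSplit H d s A L) (hx : x ∈ L) :
    H.neighborFinset x \ L = A := by
  ext v
  rw [mem_sdiff, mem_neighborFinset, adj_comm]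
  exact ⟨fun h => (hS.adj_iff v h.2 x hx).1 h.1,
    fun h => ⟨hS.adj h hx, disjoint_left.1 hS.disjoint h⟩⟩

lemma card_sdiff_neighborFinset_add (hS : IsSplit H d s A L) (hx : x ∈ L) :
    #(L \ H.neighborFinset x) + d = s + #A := by
  have h1 := card_sdiff_add_card_inter (H.neighborFinset x) L
  have h2 := card_sdiff_add_card_inter L (H.neighborFinset x)
  rw [hS.neighborFinset_sdiff hx, card_neighborFinset_eq_degree, hS.degree_eq x hx] at h1
  rw [inter_comm, hS.card_eq] at h2
  omega

lemma lt_add_card (hS : IsSplit H d s A L) (hx : x ∈ L) : d < s + #A := by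
  have : 0 < #(L \ H.neighborFinset x) := card_pos.2 ⟨x, by simp [hx]⟩
  have := hS.card_sdiff_neighborFinset_add hx
  omega

lemma card_le (hS : IsSplit H d s A L) (hx : x ∈ L) : #A ≤ d := by
  rw [← hS.neighborFinset_sdiff hx, ← hS.degree_eq x hx]
  exact card_le_card sdiff_subset

lemma card_compl_union_add (hS : IsSplit H d s A L) :
    #(A ∪ L)ᶜ + #A + s = Fintype.card V := by
  have := card_add_card_compl (A ∪ L)
  rw [card_union_of_disjoint hS.disjoint, hS.card_eq] at this
  omega

lemma disjoint_of_le_between (hS : IsSplit H d s A L) {N : SimpleGraph V}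
    (hF : IsMaxBMatching H (fun v => if v ∈ L then k else 0) F) (hN : N ≤ H.between A L) :
    Disjoint F N := by
  refine disjoint_left.2 fun x y hF' hN' => ?_
  rcases (between_adj.1 (hN hN')).2 with h | h
  · exact disjoint_left.1 hS.disjoint h.1 (hF.mem_of_adj hF'.symm)
  · exact disjoint_left.1 hS.disjoint h.2 (hF.mem_of_adj hF')

lemma exists_le_degree_eq (hS : IsSplit H d s A L)
    (hF : IsMaxBMatching H (fun v => if v ∈ L then k else 0) F)
    (hle : ∀ x ∈ L, k - F.degree x ≤ #A) (hsum : ∑ x ∈ L, (k - F.degree x) ≤ k * #A) :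
    ∃ M ≤ H, (∀ x y, M.Adj x y → x ∈ L ∨ y ∈ L) ∧ (∀ v, M.degree v ≤ k) ∧
      (∀ x ∈ L, M.degree x = k) ∧ ∀ v ∉ A ∪ L, M.degree v = 0 := by
  obtain ⟨N, hNle, hNL, hNA⟩ :=
    exists_le_between_degree_eq (fun a ha x hx => hS.adj ha hx) hle hsum
  have hN : ∀ x y, N.Adj x y → x ∈ A ∧ y ∈ L ∨ x ∈ L ∧ y ∈ A :=
    fun x y hxy => by simpa using (between_adj.1 (hNle hxy)).2
  obtain ⟨M, hM⟩ : ∃ M, M = F ⊔ N := ⟨_, rfl⟩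
  have hdeg : ∀ v, M.degree v = F.degree v + N.degree v := fun v => by
    subst hM
    convert degree_sup_of_disjoint (hS.disjoint_of_le_between hF hNle)
  have hL : ∀ x ∈ L, M.degree x = k := fun x hx => by
    rw [hdeg, hNL x hx, Nat.add_sub_cancel' (hF.degree_le_of_mem hx)]
  have hA : ∀ v ∈ A, M.degree v ≤ k := fun v hv => by
    rw [hdeg, hF.degree_eq_zero_of_notMem (disjoint_left.1 hS.disjoint hv), zero_add]
    exact hNA v hv
  have hB : ∀ v ∉ A ∪ L, M.degree v = 0 := fun v hv => by
    rw [mem_union, not_or] at hv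
    rw [hdeg, hF.degree_eq_zero_of_notMem hv.2, zero_add]
    by_contra h
    obtain ⟨w, hw⟩ := (N.degree_pos_iff_exists_adj v).1 (Nat.pos_of_ne_zero h)
    exact (hN v w hw).elim (fun h => hv.1 h.1) fun h => hv.2 h.1
  refine ⟨M, hM ▸ sup_le hF.le (hNle.trans between_le), fun x y hxy => ?_, fun v => ?_, hL, hB⟩
  · rw [hM, sup_adj] at hxy
    exact hxy.elim (fun h => .inr (hF.mem_of_adj h)) fun h => (hN x y h).symm.imp And.left And.right
  · by_cases hv : v ∈ A ∪ L
    · exact (mem_union.1 hv).elim (hA v) fun h => (hL v h).le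
    · exact (hB v hv).trans_le (Nat.zero_le k)

lemma hasFactor (hS : IsSplit H d s A L)
    (hF : IsMaxBMatching H (fun v => if v ∈ L then k else 0) F)
    (hle : ∀ x ∈ L, k - F.degree x ≤ #A) (hsum : ∑ x ∈ L, (k - F.degree x) ≤ k * #A)
    (hcard : 2 * k ≤ #(A ∪ L)ᶜ + 1) (heven : Even (Fintype.card V * k)) : HasFactor H k := by
  obtain ⟨M, hMle, hMadj, hMk, hML, hMB⟩ := hS.exists_le_degree_eq hF hle hsum
  have hsumM : Even (∑ v, (k - M.degree v)) := by
    have hadd : ∑ v, (k - M.degree v) + ∑ v, M.degree v = Fintype.card V * k := by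
      rw [← sum_add_distrib, sum_congr rfl fun v _ => Nat.sub_add_cancel (hMk v), sum_const,
        card_univ, smul_eq_mul]
    exact (Nat.even_add.1 (hadd ▸ heven)).2 (even_sum_degree M)
  obtain ⟨N, hN⟩ := exists_degree_eq_of_even (b := fun v => k - M.degree v) (B := (A ∪ L)ᶜ)
    (fun v => Nat.sub_le _ _) (fun v hv => by simp only [hMB v (mem_compl.1 hv), Nat.sub_zero])
    hcard hsumM
  have hNL : ∀ x y, N.Adj x y → x ∉ L := fun x y hxy hx => by
    have h0 : N.degree x = 0 := by rw [hN, hML x hx, Nat.sub_self]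
    exact ((N.degree_pos_iff_exists_adj x).2 ⟨y, hxy⟩).ne' h0
  have hdisj : Disjoint M N := disjoint_left.2 fun x y hxyM hxyN =>
    (hMadj x y hxyM).elim (hNL x y hxyN) (hNL y x hxyN.symm)
  refine hasFactor_iff.2 ⟨M ⊔ N, sup_le hMle fun x y hxy => ?_, fun v => ?_⟩
  · exact hS.isClique (hNL x y hxy) (hNL y x hxy.symm) hxy.ne
  · rw [← Nat.add_sub_cancel' (hMk v), ← hN]
    convert degree_sup_of_disjoint hdisj

lemma hasFactor_of_two_le (hS : IsSplit H δ (δ + 1 - (2 * k - 3)) A L) (hk : 2 ≤ k)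
    (hδ : 2 * k - 2 ≤ δ) (hcard : 2 * δ + k + 1 ≤ Fintype.card V)
    (heven : Even (Fintype.card V * k)) : HasFactor H k := by
  have hL : 1 < #L := by
    rw [hS.card_eq]
    omega
  obtain ⟨x, hx⟩ := card_pos.1 (Nat.zero_lt_of_lt hL)
  have hA := hS.card_le hx
  have hlt := hS.lt_add_card hx
  have hB := hS.card_compl_union_add
  obtain ⟨F, hF⟩ := exists_isMaxBMatching H fun v => if v ∈ L then k else 0
  have hm : ∀ y ∈ L, #(L \ H.neighborFinset y) ≤ #A + 4 - 2 * k := fun y hy => by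
    have := hS.card_sdiff_neighborFinset_add hy
    omega
  have ha : #A + 4 - 2 * k + 2 * k - 4 = #A := by omega
  refine hS.hasFactor hF (fun y hy => ?_) ?_ (by omega) heven
  · exact ha ▸ hF.deficiency_le_of_two_le hk hm hL hy
  · exact ha ▸ hF.sum_deficiency_le_of_two_le hk hm (by omega)

lemma hasFactor_one (hS : IsSplit H δ (δ + 1) A L) (hcard : 2 * δ + 2 ≤ Fintype.card V)
    (heven : Even (Fintype.card V)) (hA0 : #A = 0 → ¬ Even δ) (hA : #A ≠ δ) : HasFactor H 1 := by
  have hL := hS.card_eq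
  obtain ⟨x, hx⟩ := card_pos.1 (show 0 < #L by omega)
  have hAδ := hS.card_le hx
  have hB := hS.card_compl_union_add
  obtain ⟨F, hF⟩ := exists_isMaxBMatching H fun v => if v ∈ L then 1 else 0
  have hsum : ∑ x ∈ L, (1 - F.degree x) ≤ #A :=
    hF.sum_deficiency_le_of_eq_one
      (fun y hy => by have := hS.card_sdiff_neighborFinset_add hy; omega)
      (fun h => by rw [hL, Nat.even_add_one]; exact hA0 h) (fun _ => by omega)
  refine hS.hasFactor hF (fun y hy => ?_) (by rwa [one_mul]) (by omega) (by rwa [mul_one])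
  exact (single_le_sum (f := fun x => 1 - F.degree x) (fun _ _ => Nat.zero_le _) hy).trans hsum

end IsSplit

end Split

section DiscreteConvexity

variable {M : Type*} [AddCommGroup M] [LinearOrder M] [IsOrderedAddMonoid M]

lemma le_max_of_monotoneOn_sub {f : ℕ → M} {l h m : ℕ}
    (hf : MonotoneOn (fun q => f (q + 1) - f q) (Set.Ico l m)) (hl : l ≤ h) (hm : h ≤ m) :
    f h ≤ max (f l) (f m) := by
  rcases hm.eq_or_lt with rfl | hm'
  · exact le_max_right _ _
  rcases le_total 0 (f (h + 1) - f h) with h0 | h0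
  · have hmono : MonotoneOn f (Set.Icc h m) :=
      monotoneOn_of_le_succ Set.ordConnected_Icc fun q _ hq hq' => sub_nonneg.1 <|
        h0.trans (hf ⟨hl, hm'⟩ ⟨hl.trans hq.1, Nat.lt_of_succ_le hq'.2⟩ hq.1)
    exact le_max_of_le_right (hmono ⟨le_rfl, hm⟩ ⟨hm, le_rfl⟩ hm)
  · have hanti : AntitoneOn f (Set.Icc l h) :=
      antitoneOn_of_succ_le Set.ordConnected_Icc fun q _ hq hq' => sub_nonpos.1 <|
        (hf ⟨hq.1, hq.2.trans_lt hm'⟩ ⟨hl, hm'⟩ hq.2).trans h0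
    exact le_max_of_le_left (hanti ⟨le_rfl, hl⟩ ⟨hl, le_rfl⟩ hl)

end DiscreteConvexity

section CliqueBound

variable {V : Type*} [Fintype V] {H : SimpleGraph V} {c h k l m n q r : ℕ}

lemma card_cliqueFinset_le (S : Finset V) (hS : ∀ v ∈ S, H.degree v ≤ q) :
    #(H.cliqueFinset r) ≤ (Fintype.card V - #S).choose r + #S * q.choose (r - 1) := by
  have hsub : H.cliqueFinset r ⊆ powersetCard r Sᶜ ∪
      S.biUnion fun v => (powersetCard (r - 1) (H.neighborFinset v)).image (insert v) := by
    intro T hT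
    rw [mem_cliqueFinset_iff, isNClique_iff] at hT
    by_cases hTS : ∃ v ∈ T, v ∈ S
    · obtain ⟨v, hvT, hvS⟩ := hTS
      refine mem_union_right _ (mem_biUnion.2 ⟨v, hvS, mem_image.2 ⟨T.erase v, ?_, ?_⟩⟩)
      · rw [mem_powersetCard, card_erase_of_mem hvT, hT.2]
        refine ⟨fun w hw => (H.mem_neighborFinset v w).2 ?_, rfl⟩
        exact hT.1 hvT (mem_of_mem_erase hw) (ne_of_mem_erase hw).symm
      · exact insert_erase hvT
    · exact mem_union_left _ <| mem_powersetCard.2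
        ⟨fun w hw => mem_compl.2 fun hwS => hTS ⟨w, hw, hwS⟩, hT.2⟩
  refine (card_le_card hsub).trans ((card_union_le _ _).trans (Nat.add_le_add ?_ ?_))
  · rw [card_powersetCard, card_compl]
  · refine card_biUnion_le_card_mul _ _ _ fun v hv => card_image_le.trans ?_
    rw [card_powersetCard]
    exact Nat.choose_le_choose _ (hS v hv)

/-- The bound of `card_cliqueFinset_le` for a graph of order `n` with `q + 1 - c` vertices of
degree at most `q`. It is `phiOne n r q` for `c = 0` and `phiTwo n r k q` for `c = 2 * k - 3`. -/
def cliqueBound (n r c q : ℕ) : ℕ :=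
  (n - (q + 1 - c)).choose r + (q + 1 - c) * q.choose (r - 1)

lemma phiOne_eq_cliqueBound (n r q : ℕ) : phiOne n r q = cliqueBound n r 0 q := by
  rw [phiOne, cliqueBound, Nat.sub_zero, Nat.sub_sub]

lemma phiTwo_eq_cliqueBound (n r : ℕ) (hk : 2 ≤ k) (hq : 2 * k ≤ q + 4) :
    phiTwo n r k q = cliqueBound n r (2 * k - 3) q := by
  have h1 : q + 1 - (2 * k - 3) = q + 4 - 2 * k := by omega
  have h2 : n - (q + 4 - 2 * k) = n + 2 * k - 4 - q := by omega
  rw [phiTwo, cliqueBound, h1, h2]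

lemma card_cliqueFinset_le_cliqueBound {S : Finset V} (hS : ∀ v ∈ S, H.degree v ≤ q)
    (hcard : q + 1 - c ≤ #S) : #(H.cliqueFinset r) ≤ cliqueBound (Fintype.card V) r c q := by
  obtain ⟨T, hT, hTc⟩ := exists_subset_card_eq hcard
  exact (card_cliqueFinset_le T fun v hv => hS v (hT hv)).trans_eq (by rw [hTc, cliqueBound])

lemma cliqueBound_succ_sub (hr : 2 ≤ r) (hc : c ≤ q) (hq : q + 2 ≤ n + c) :
    (cliqueBound n r c (q + 1) : ℤ) - cliqueBound n r c q =
      q.choose (r - 1) + (q + 2 - c : ℕ) * q.choose (r - 2)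
        - (n - (q + 2 - c)).choose (r - 1) := by
  obtain ⟨r, rfl⟩ := Nat.exists_eq_add_of_le' hr
  obtain ⟨t, rfl⟩ := Nat.exists_eq_add_of_le' hc
  obtain ⟨n, rfl⟩ : ∃ n', n = n' + (t + 2) := Nat.exists_eq_add_of_le' (by omega)
  have h1 : t + c + 1 + 1 - c = t + 2 := by omega
  have h2 : t + c + 1 - c = t + 1 := by omega
  have h3 : n + (t + 2) - (t + 1) = n + 1 := by omega
  simp only [cliqueBound, h1, h2, h3, Nat.add_sub_cancel, Nat.add_one_sub_one]
  rw [Nat.choose_succ_succ n, Nat.choose_succ_succ (t + c) r]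
  push_cast
  ring

lemma cliqueBound_le_max (hr : 2 ≤ r) (hc : c ≤ l) (hmn : m + 1 ≤ n + c) (hl : l ≤ h)
    (hm : h ≤ m) : cliqueBound n r c h ≤ max (cliqueBound n r c l) (cliqueBound n r c m) := by
  have hmono : MonotoneOn
      (fun q => (cliqueBound n r c (q + 1) : ℤ) - cliqueBound n r c q) (Set.Ico l m) := by
    intro q hq q' hq' hqq'
    obtain ⟨hlq, hqm⟩ := hq
    obtain ⟨hlq', hqm'⟩ := hq'
    simp only
    rw [cliqueBound_succ_sub hr (by omega) (by omega),
      cliqueBound_succ_sub hr (by omega) (by omega)]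
    gcongr
  exact_mod_cast le_max_of_monotoneOn_sub (f := fun q => (cliqueBound n r c q : ℤ)) hmono hl hm

end CliqueBound

section Structure

variable {V : Type*} [Fintype V] {H : SimpleGraph V} {c r δ : ℕ} {v x : V}

lemma card_compl_neighborFinset (H : SimpleGraph V) (v : V) :
    #(Hᶜ.neighborFinset v) = Fintype.card V - 1 - H.degree v := by
  rw [← degree_compl, ← card_neighborFinset_eq_degree]

lemma exists_le_card_degree_le
    (hcl : ∀ u v, u ≠ v → ¬ H.Adj u v → H.degree u + H.degree v < Fintype.card V - 1 + c)
    (hne : ¬ H.IsClique {v | δ < H.degree v}) :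
    ∃ h, δ < h ∧ h ≤ (Fintype.card V - 2 + c) / 2 ∧ h + 1 - c ≤ #{w | H.degree w ≤ h} := by
  have hcl' : ∀ {u v}, Hᶜ.Adj u v → H.degree u + H.degree v < Fintype.card V - 1 + c :=
    fun huv => hcl _ _ huv.1 huv.2
  obtain ⟨x, hx, y, hy, hxy⟩ :
      ∃ x, δ < H.degree x ∧ ∃ y, δ < H.degree y ∧ Hᶜ.Adj x y := by
    simpa [IsClique, Set.Pairwise] using hne
  obtain ⟨v, hv, hvmax⟩ := exists_max_image
    {v | δ < H.degree v ∧ ∃ u, δ < H.degree u ∧ Hᶜ.Adj v u} (fun w => H.degree w)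
    ⟨x, mem_filter.2 ⟨mem_univ x, hx, y, hy, hxy⟩⟩
  obtain ⟨-, hv, z, hz, hvz⟩ := mem_filter.1 hv
  obtain ⟨u, hu, humax⟩ := exists_max_image (Hᶜ.neighborFinset v)
    (fun w => H.degree w)
    ⟨z, (Hᶜ.mem_neighborFinset v z).2 hvz⟩
  have hzu := humax z ((Hᶜ.mem_neighborFinset v z).2 hvz)
  rw [mem_neighborFinset] at hu
  have huv : H.degree u ≤ H.degree v :=
    hvmax u (mem_filter.2 ⟨mem_univ u, by omega, v, hv, hu.symm⟩)
  have hsum := hcl' hu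
  have hcard : #(Hᶜ.neighborFinset v) ≤ #{w | H.degree w ≤ H.degree u} :=
    card_le_card fun w hw => mem_filter.2 ⟨mem_univ w, humax w hw⟩
  rw [card_compl_neighborFinset] at hcard
  exact ⟨H.degree u, by omega, by omega, by omega⟩

lemma isClique_of_lt_card_cliqueFinset (hr : 2 ≤ r) (hc : c ≤ δ + 1)
    (hcl : ∀ u v, u ≠ v → ¬ H.Adj u v → H.degree u + H.degree v < Fintype.card V - 1 + c)
    (hN : max (cliqueBound (Fintype.card V) r c (δ + 1))
      (cliqueBound (Fintype.card V) r c ((Fintype.card V - 2 + c) / 2)) < #(H.cliqueFinset r)) :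
    H.IsClique {v | δ < H.degree v} := by
  by_contra hne
  obtain ⟨h, hδh, hh, hcard⟩ := exists_le_card_degree_le hcl hne
  refine hN.not_ge ((card_cliqueFinset_le_cliqueBound (fun v hv => (mem_filter.1 hv).2) hcard).trans
    (cliqueBound_le_max hr hc ?_ hδh hh))
  omega

lemma card_degree_le_of_lt_card_cliqueFinset
    (hN : cliqueBound (Fintype.card V) r c (δ + 1) < #(H.cliqueFinset r)) :
    #{v | H.degree v ≤ δ} ≤ δ + 1 - c := by
  by_contra! hlt
  exact hN.not_ge (card_cliqueFinset_le_cliqueBound (S := {v | H.degree v ≤ δ})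
    (fun v hv => (mem_filter.1 hv).2.trans δ.le_succ) (by omega))

lemma compl_neighborFinset_eq (hδ : ∀ v, δ ≤ H.degree v)
    (hcl : ∀ u v, u ≠ v → ¬ H.Adj u v → H.degree u + H.degree v < Fintype.card V - 1 + c)
    (hclique : H.IsClique {v | δ < H.degree v}) (hcard : #{v | H.degree v ≤ δ} ≤ δ + 1 - c)
    (hv : δ < H.degree v) (hx : H.degree x ≤ δ) (hvx : ¬ H.Adj v x) :
    Hᶜ.neighborFinset v = ({w | H.degree w ≤ δ} : Finset V) ∧
      #{w | H.degree w ≤ δ} = δ + 1 - c := by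
  have hsub : Hᶜ.neighborFinset v ⊆ ({w | H.degree w ≤ δ} : Finset V) := fun w hw => by
    rw [mem_neighborFinset, compl_adj] at hw
    refine mem_filter.2 ⟨mem_univ w, ?_⟩
    by_contra! hlt
    exact hw.2 (hclique hv hlt hw.1)
  have hsum := hcl v x (by rintro rfl; omega) hvx
  have hle := card_le_card hsub
  have := hδ x
  have := card_compl_neighborFinset H v
  exact ⟨eq_of_subset_of_card_le hsub (by omega), by omega⟩

lemma exists_isSplit (hδ : ∀ v, δ ≤ H.degree v) (hn : 2 * δ + 2 ≤ Fintype.card V)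
    (hcl : ∀ u v, u ≠ v → ¬ H.Adj u v → H.degree u + H.degree v < Fintype.card V - 1 + c)
    (hclique : H.IsClique {v | δ < H.degree v}) (hcard : #{v | H.degree v ≤ δ} ≤ δ + 1 - c)
    (hne : H ≠ ⊤) : ∃ A L, IsSplit H δ (δ + 1 - c) A L := by
  set L : Finset V := {v | H.degree v ≤ δ} with hL
  have memL : ∀ v, v ∈ L ↔ H.degree v ≤ δ := by simp [hL]
  set A : Finset V := {v | v ∉ L ∧ ∀ x ∈ L, H.Adj v x} with hA
  have memA : ∀ v, v ∈ A ↔ v ∉ L ∧ ∀ x ∈ L, H.Adj v x := by simp [hA]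
  have hcompl : ∀ v ∉ L, v ∉ A → Hᶜ.neighborFinset v = L ∧ #L = δ + 1 - c := by
    intro v hv hvA
    obtain ⟨x, hx, hvx⟩ : ∃ x ∈ L, ¬ H.Adj v x := by
      by_contra! h
      exact hvA ((memA v).2 ⟨hv, h⟩)
    exact compl_neighborFinset_eq hδ hcl hclique hcard (by simpa [memL] using hv)
      ((memL x).1 hx) hvx
  have hcliqueL : H.IsClique (L : Set V)ᶜ := by simpa [hL, Set.compl_ofPred] using hclique
  obtain ⟨x, hx⟩ : L.Nonempty := by
    by_contra! h
    exact hne (isClique_univ.1 (by simpa [h] using hcliqueL))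
  have hdegL : ∀ x ∈ L, H.degree x = δ := fun x hx => ((memL x).1 hx).antisymm (hδ x)
  have hcardA : #A ≤ δ := by
    rw [← hdegL x hx]
    exact card_le_card fun v hv => (H.mem_neighborFinset x v).2 (((memA v).1 hv).2 x hx).symm
  obtain ⟨b, hb⟩ : ((A ∪ L)ᶜ).Nonempty := by
    rw [← card_pos, card_compl]
    have := card_union_le A L
    omega
  rw [mem_compl, mem_union, not_or] at hb
  refine ⟨A, L, disjoint_left.2 fun v hv => ((memA v).1 hv).1, hcliqueL, fun v hv x hx =>
    ⟨fun hvx => ?_, fun h => ((memA v).1 h).2 x hx⟩, hdegL, (hcompl b hb.2 hb.1).2⟩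
  by_contra hvA
  rw [← (hcompl v hv hvA).1, mem_neighborFinset] at hx
  exact hx.2 hvx

end Structure

section FactorsOfSums

variable {U V W : Type*} {G : SimpleGraph U} {H : SimpleGraph V} {K : SimpleGraph W} {k : ℕ}

lemma HasFactor.of_iso (e : H ≃g K) (h : HasFactor H k) : HasFactor K k := by
  obtain ⟨F, hF, hfin, hdeg⟩ := h
  let e' := Iso.comap e.symm.toEquiv F
  let hfin' : (F.comap e.symm.toEquiv).LocallyFinite := fun w =>
    Fintype.ofEquiv _ (e'.mapNeighborSet w).symm
  exact ⟨F.comap e.symm.toEquiv, fun x y hxy => e.symm.map_adj_iff.1 (hF hxy), hfin',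
    fun w => (e'.degree_eq w).symm.trans (hdeg (e.symm w))⟩

lemma HasFactor.of_sum_right (h : HasFactor (H ⊕g K) k) : HasFactor K k := by
  obtain ⟨F, hF, hfin, hdeg⟩ := h
  have hfin' : (F.comap Sum.inr).LocallyFinite := fun w =>
    Fintype.ofInjective (fun x => (⟨.inr x, x.2⟩ : F.neighborSet (.inr w)))
      fun x y hxy => by simpa [Subtype.ext_iff] using hxy
  refine ⟨F.comap Sum.inr, fun x y hxy => by simpa using hF hxy, hfin', fun w => ?_⟩
  have hmap : ((F.comap Sum.inr).neighborFinset w).map .inr = F.neighborFinset (.inr w) := by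
    ext (v | w')
    · have : ¬ F.Adj (.inr w) (.inl v) := fun hadj => by simpa using hF hadj
      simpa using this
    · simp
  rw [← hdeg (.inr w), ← card_neighborFinset_eq_degree, ← card_neighborFinset_eq_degree, ← hmap,
    card_map]

lemma HasFactor.card_mul_le_of_graphJoin [Fintype U] [Finite V] [Fintype W]
    (h : HasFactor (graphJoin G (H ⊕g emptyGraph W)) k) :
    Fintype.card W * k ≤ Fintype.card U * k := by
  have := Fintype.ofFinite V
  obtain ⟨F, hF, hdeg⟩ := hasFactor_iff.1 h
  have := card_mul_le_of_neighborFinset_subset (F := F) (k := k)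
    (I := univ.map (.trans .inr .inr)) (S := univ.map .inl)
    (fun x _ => (hdeg x).ge) (fun x hx y hxy => ?_) (fun y _ => (hdeg y).le)
  · simpa using this
  · obtain ⟨w, -, rfl⟩ := mem_map.1 hx
    have hadj := hF ((F.mem_neighborFinset _ y).1 hxy)
    rcases y with u | v | w' <;> simp_all [graphJoin]

lemma HasFactor.not_nonempty_iso_exceptionalUnion {n δ : ℕ} (h : HasFactor H 1) (hδ : Even δ) :
    ¬ Nonempty (H ≃g exceptionalUnion n δ) := fun ⟨e⟩ => by
  have heven := (h.of_iso e).of_sum_right.even_card_mul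
  rw [Fintype.card_fin, mul_one, Nat.even_add_one] at heven
  exact heven hδ

lemma HasFactor.not_nonempty_iso_exceptionalJoin {n δ : ℕ} (h : HasFactor H 1) :
    ¬ Nonempty (H ≃g exceptionalJoin n δ) := fun ⟨e⟩ => by
  have := (h.of_iso e).card_mul_le_of_graphJoin
  simp at this

end FactorsOfSums

section Recognition

variable {V W : Type*} [Fintype V] [Fintype W] {H : SimpleGraph V} {K : SimpleGraph W} {δ : ℕ}
  {A L : Finset V}

lemma card_filter_sumType (p : V ⊕ W → Prop) [DecidablePred p] :
    #{y | p y} = #{v | p (.inl v)} + #{w | p (.inr w)} := by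
  simp only [card_filter, Fintype.sum_sum_type]

lemma nonempty_iso_of_adj_iff {C : Type*} [DecidableEq C] {r : C → C → Prop} {f : V → C}
    {g : W → C}
    (hH : ∀ x y, H.Adj x y ↔ x ≠ y ∧ r (f x) (f y))
    (hK : ∀ x y, K.Adj x y ↔ x ≠ y ∧ r (g x) (g y))
    (hcard : ∀ c, #{x | f x = c} = #{y | g y = c}) : Nonempty (H ≃g K) := by
  have e : ∀ c, {x // f x = c} ≃ {y // g y = c} := fun c =>
    Fintype.equivOfCardEq (by rw [Fintype.card_subtype, Fintype.card_subtype, hcard])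
  refine ⟨⟨Equiv.ofFiberEquiv e, fun {x y} => ?_⟩⟩
  rw [hK, hH, Equiv.ofFiberEquiv_map e, Equiv.ofFiberEquiv_map e, (Equiv.injective _).ne_iff]

namespace IsSplit

lemma adj_iff_of_card_eq_zero (hS : IsSplit H δ (δ + 1) A L) (hA : #A = 0) (x y : V) :
    H.Adj x y ↔ x ≠ y ∧ (x ∈ L ↔ y ∈ L) := by
  have hAempty := card_eq_zero.1 hA
  have hnadj : ∀ v ∉ L, ∀ x ∈ L, ¬ H.Adj v x := fun v hv x hx => by
    simp [hS.adj_iff v hv x hx, hAempty]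
  have hL : ∀ x ∈ L, ∀ y ∈ L, x ≠ y → H.Adj x y := fun x hx y hy hxy => by
    have hcard : #(L \ H.neighborFinset x) ≤ 1 := by
      have := hS.card_sdiff_neighborFinset_add hx
      omega
    by_contra hadj
    exact hxy (card_le_one.1 hcard x (by simp [hx]) y (by simp [hy, hadj]))
  by_cases hx : x ∈ L <;> by_cases hy : y ∈ L
  · simpa only [hx, hy, iff_self, and_true] using ⟨Adj.ne, hL x hx y hy⟩
  · simpa only [hx, hy, iff_false, not_true, and_false] using fun h => hnadj y hy x hx h.symm
  · simpa only [hx, hy, iff_true, and_false, iff_false] using hnadj x hx y hy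
  · simpa only [hx, hy, iff_self, and_true] using ⟨Adj.ne, hS.isClique hx hy⟩

lemma nonempty_iso_exceptionalUnion (hS : IsSplit H δ (δ + 1) A L) (hA : #A = 0) :
    Nonempty (H ≃g exceptionalUnion (Fintype.card V) δ) := by
  refine nonempty_iso_of_adj_iff (r := Eq) (f := fun x => decide (x ∈ L)) (g := Sum.isRight)
    (fun x y => by rw [hS.adj_iff_of_card_eq_zero hA, decide_eq_decide]) ?_ ?_
  · rintro (x | x) (y | y) <;> simp
  · have hL := hS.card_eq
    have hLc : #{x | x ∉ L} = Fintype.card V - δ - 1 := by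
      rw [filter_notMem_eq_sdiff, ← compl_eq_univ_sdiff, card_compl, hL, Nat.sub_sub]
    rintro (_ | _) <;> rw [card_filter_sumType]
    · simpa using hLc
    · simpa using hL

lemma not_adj_of_card_eq (hS : IsSplit H δ (δ + 1) A L) (hA : #A = δ) {x y : V} (hx : x ∈ L)
    (hy : y ∈ L) : ¬ H.Adj x y := by
  have hcard := hS.card_sdiff_neighborFinset_add hx
  have heq : L \ H.neighborFinset x = L :=
    eq_of_subset_of_card_le sdiff_subset (by rw [hS.card_eq]; omega)
  rw [← heq, mem_sdiff, mem_neighborFinset] at hy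
  exact hy.2

lemma adj_iff_of_card_eq (hS : IsSplit H δ (δ + 1) A L) (hA : #A = δ) (x y : V) :
    H.Adj x y ↔ x ≠ y ∧ (x ∈ A ∨ y ∈ A ∨ x ∉ L ∧ y ∉ L) := by
  by_cases hx : x ∈ L <;> by_cases hy : y ∈ L
  · simp [hx, hy, hS.not_adj_of_card_eq hA hx hy, disjoint_right.1 hS.disjoint]
  · have hxA := disjoint_right.1 hS.disjoint hx
    have hne : x ≠ y := by rintro rfl; exact hy hx
    simp [hx, hy, hxA, hne, H.adj_comm x, hS.adj_iff y hy x hx]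
  · have hyA := disjoint_right.1 hS.disjoint hy
    have hne : x ≠ y := by rintro rfl; exact hx hy
    simp [hx, hy, hyA, hne, hS.adj_iff x hx y hy]
  · simpa [hx, hy] using ⟨Adj.ne, hS.isClique hx hy⟩

lemma nonempty_iso_exceptionalJoin (hS : IsSplit H δ (δ + 1) A L) (hA : #A = δ) :
    Nonempty (H ≃g exceptionalJoin (Fintype.card V) δ) := by
  refine nonempty_iso_of_adj_iff (C := Bool × Bool)
    (r := fun a b => a.1 ∨ b.1 ∨ ¬ a.2 ∧ ¬ b.2) (f := fun x => (decide (x ∈ A), decide (x ∈ L)))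
    (g := Sum.elim (fun _ => (true, false)) fun y => (false, y.isRight))
    (fun x y => by simp [hS.adj_iff_of_card_eq hA]) ?_ ?_
  · rintro (x | x | x) (y | y | y) <;> simp [graphJoin]
  · have hAL : ∀ x, x ∈ A → x ∉ L := fun _ hx => disjoint_left.1 hS.disjoint hx
    have hB : #(Aᶜ ∩ Lᶜ) = Fintype.card V - 2 * δ - 1 := by
      have := hS.card_compl_union_add
      rw [← compl_union]
      omega
    have hfilter : ∀ a b, ({x | (decide (x ∈ A), decide (x ∈ L)) = (a, b)} : Finset V) =
        bif a then (bif b then ∅ else A) else bif b then L else Aᶜ ∩ Lᶜ := by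
      rintro (_ | _) (_ | _) <;> ext x <;> have := hAL x <;> simp <;> tauto
    rintro ⟨_ | _, _ | _⟩ <;> rw [hfilter, card_filter_sumType, card_filter_sumType] <;>
      simp [hA, hB, hS.card_eq]

end IsSplit

end Recognition

section Main

variable {V : Type*} [Fintype V] {G : SimpleGraph V} {c r δ k : ℕ}

lemma eq_top_or_exists_isSplit_lClosure (hr : 2 ≤ r) (hc : c ≤ δ + 1) (hδ : ∀ v, δ ≤ G.degree v)
    (hn : 2 * δ + 2 ≤ Fintype.card V)
    (hN : max (cliqueBound (Fintype.card V) r c (δ + 1))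
      (cliqueBound (Fintype.card V) r c ((Fintype.card V - 2 + c) / 2)) <
        #(G.cliqueFinset r)) :
    lClosure (Fintype.card V - 1 + c) G = ⊤ ∨
      ∃ A L, IsSplit (lClosure (Fintype.card V - 1 + c) G) δ (δ + 1 - c) A L := by
  set H := lClosure (Fintype.card V - 1 + c) G
  have hle : G ≤ H := le_lClosure _ G
  have hNH := hN.trans_le (card_le_card (cliqueFinset_mono _ hle))
  have hcl : ∀ u v, u ≠ v → ¬ H.Adj u v → H.degree u + H.degree v < Fintype.card V - 1 + c :=
    fun u v => degree_add_degree_lClosure_lt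
  exact or_iff_not_imp_left.2 <| exists_isSplit (fun v => (hδ v).trans (degree_le_of_le hle)) hn
    hcl (isClique_of_lt_card_cliqueFinset hr hc hcl hNH)
    (card_degree_le_of_lt_card_cliqueFinset ((le_max_left _ _).trans_lt hNH))

theorem hasFactor_one_iff (hr : 2 ≤ r) (hn : 2 * δ + 2 ≤ Fintype.card V)
    (heven : Even (Fintype.card V)) (hδ : ∀ v, δ ≤ G.degree v)
    (hN : max (phiOne (Fintype.card V) r (δ + 1))
      (phiOne (Fintype.card V) r (Fintype.card V / 2 - 1)) < #(G.cliqueFinset r)) :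
    HasFactor G 1 ↔
      ¬ ((Even δ ∧ Nonempty (lClosure (Fintype.card V - 1) G ≃g
          exceptionalUnion (Fintype.card V) δ)) ∨
        Nonempty (lClosure (Fintype.card V - 1) G ≃g exceptionalJoin (Fintype.card V) δ)) := by
  refine ⟨fun h => ?_, fun hex => hasFactor_of_lClosure ?_⟩
  · have hH := h.mono (le_lClosure (Fintype.card V - 1) G)
    rintro (⟨hδeven, hiso⟩ | hiso)
    · exact hH.not_nonempty_iso_exceptionalUnion hδeven hiso
    · exact hH.not_nonempty_iso_exceptionalJoin hiso
  · rw [phiOne_eq_cliqueBound, phiOne_eq_cliqueBound,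
      show Fintype.card V / 2 - 1 = (Fintype.card V - 2 + 0) / 2 by omega] at hN
    obtain htop | ⟨A, L, hS⟩ := eq_top_or_exists_isSplit_lClosure hr (Nat.zero_le _) hδ hn hN
    · rw [htop]
      exact hasFactor_top (by omega) (by simpa using heven)
    · exact hS.hasFactor_one hn heven
        (fun hA hδeven => hex (.inl ⟨hδeven, hS.nonempty_iso_exceptionalUnion hA⟩))
        fun hA => hex (.inr (hS.nonempty_iso_exceptionalJoin hA))

theorem hasFactor_of_lt_card_cliqueFinset (hr : 2 ≤ r) (hk : 2 ≤ k) (hkδ : 2 * k - 2 ≤ δ)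
    (hn : 2 * δ + k + 1 ≤ Fintype.card V) (heven : Even (Fintype.card V * k))
    (hδ : ∀ v, δ ≤ G.degree v)
    (hN : max (phiTwo (Fintype.card V) r k (δ + 1))
      (phiTwo (Fintype.card V) r k ((Fintype.card V + 2 * k - 5) / 2)) < #(G.cliqueFinset r)) :
    HasFactor G k := by
  rw [phiTwo_eq_cliqueBound _ _ hk (by omega), phiTwo_eq_cliqueBound _ _ hk (by omega),
    show Fintype.card V + 2 * k - 5 = Fintype.card V - 2 + (2 * k - 3) by omega] at hN
  apply hasFactor_of_lClosure
  obtain htop | ⟨A, L, hS⟩ :=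
    eq_top_or_exists_isSplit_lClosure hr (by omega) hδ (by omega) hN
  · rw [htop]
    exact hasFactor_top (by omega) heven
  · exact hS.hasFactor_of_two_le hk hkδ hn heven

end Main

end KFactor

theorem theorem1p3 {V : Type*} [Fintype V] [DecidableEq V] (G : SimpleGraph V)
    [DecidableRel G.Adj] (n r k δ : ℕ) (hr : 2 ≤ r) (hk : 1 ≤ k)
    (hn : Fintype.card V = n) (hnδ : 2 * δ + k + 1 ≤ n) (hnk : Even (n * k))
    (hδ : δ ≤ G.minDegree) :
    -- (i); for `k = 1` the parity condition `Even n` is `hnk`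
    (Even n → 1 ≤ δ → δ ≤ n / 2 - 1 →
      max (KFactor.phiOne n r (δ + 1)) (KFactor.phiOne n r (n / 2 - 1)) <
        (G.cliqueFinset r).card →
      (KFactor.HasFactor G 1 ↔
        ¬ ((Even δ ∧ Nonempty (KFactor.lClosure (n - 1) G ≃g KFactor.exceptionalUnion n δ)) ∨
          Nonempty (KFactor.lClosure (n - 1) G ≃g KFactor.exceptionalJoin n δ)))) ∧
    -- (ii)
    (2 ≤ k → 2 * k - 2 ≤ δ → δ ≤ (n + 2 * k - 5) / 2 →
      max (KFactor.phiTwo n r k (δ + 1)) (KFactor.phiTwo n r k ((n + 2 * k - 5) / 2)) <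
        (G.cliqueFinset r).card →
      KFactor.HasFactor G k) := by
  classical
  subst hn
  have hdeg : ∀ v, δ ≤ G.degree v := fun v => hδ.trans (G.minDegree_le_degree v)
  refine ⟨fun heven _ _ hN => ?_, fun hk2 hkδ _ hN => ?_⟩
  · refine KFactor.hasFactor_one_iff hr (by omega) heven (fun v => ?_) ?_
    · convert hdeg v
    · convert hN
  · refine KFactor.hasFactor_of_lt_card_cliqueFinset hr hk2 hkδ hnδ hnk (fun v => ?_) ?_
    · convert hdeg v
    · convert hN
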